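/- Let $\Bbbk=\mathbb{R}$ or $\mathbb{C}$, with $\langle x,y\rangle=x^*y$ and the Euclidean norm on $\Bbbk^d$, and let $\mathbb{S}^n(\Bbbk)$ be the set of $n\times n$ matrices $A=(a_{ij})$ over $\Bbbk$ with $A^*=A$. For $A\in\mathbb{S}^n(\Bbbk)$ define $$q_{=}(A)=\max\{x^*Ax : x\in\Bbbk^n,\ |x_i|=1 \text{ for all } i\},\qquad q_{\le}(A)=\max\{x^*Ax : x\in\Bbbk^n,\ |x_i|\le 1 \text{ for all } i\},$$ $$r_{=}(A)=\max\{\operatorname{tr}(AX) : X\in\mathbb{S}^n(\Bbbk),\ X\succeq 0,\ x_{ii}=1 \text{ for all } i\},\qquad r_{\le}(A)=\max\{\operatorname{tr}(AX) : X\in\mathbb{S}^n(\Bbbk),\ X\succeq 0,\ x_{ii}\le 1 \text{ for all } i\}.$$ Let $K_\gamma^{\Bbbk}$ be the smallest constant $K$ such that $$\max_{\|x_i\|=1}\Bigl|\sum_{i,j=1}^n a_{ij}\langle x_i,x_j\rangle\Bigr|\le K\max_{|\delta_i|=1}\Bigl|\sum_{i,j=1}^n a_{ij}\bar\delta_i\delta_j\Bigr|$$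 for all $n$, all $d\ge n$ and all $A\in\mathbb{S}^n(\Bbbk)$, where the maxima are over $x_1,\dots,x_n\in\Bbbk^d$ and $\delta_1,\dots,\delta_n\in\Bbbk$; and let $K_\Gamma^{\Bbbk}$ be the smallest constant $K$ such that the same holds with $\|x_i\|=1$ and $|\delta_i|=1$ replaced by $\|x_i\|\le1$ and $|\delta_i|\le1$. Then for all $n\in\mathbb{N}$ and all $A\in\mathbb{S}^n(\Bbbk)$, $$\max\{q_{=}(A),q_{=}(-A)\}\le\max\{r_{=}(A),r_{=}(-A)\}\le K_\gamma^{\Bbbk}\max\{q_{=}(A),q_{=}(-A)\},$$ $$\max\{q_{\le}(A),q_{\le}(-A)\}\le\max\{r_{\le}(A),r_{\le}(-A)\}\le K_\Gamma^{\Bbbk}\max\{q_{\le}(A),q_{\le}(-A)\}.$$ Moreover, the constants are sharp: $K_\gamma^{\Bbbk}$ and $K_\Gamma^{\Bbbk}$ are the smallest constants for which the right-hand inequality in the first line, respectively the second line, holds for all $n$ and all $A\in\mathbb{S}^n(\Bbbk)$. -/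

import Mathlib

open scoped ComplexOrder

namespace SymGrothendieck

noncomputable section

variable {𝕜 : Type*} [RCLike 𝕜] {n : ℕ}

/-! All maxima below are written as suprema of nonempty compact (for `n ≤ d`) sets of reals. -/

/-- The seminorm `‖A‖_γ`, computed with vectors in `𝕜^d`: the maximum of
`|∑ i, ∑ j, a_ij ⟨x_i, x_j⟩|` over unit vectors `x_1, …, x_n ∈ 𝕜^d`. -/
def gammaNorm (d : ℕ) (A : Matrix (Fin n) (Fin n) 𝕜) : ℝ :=
  sSup {t : ℝ | ∃ x : Fin n → EuclideanSpace 𝕜 (Fin d), (∀ i, ‖x i‖ = 1) ∧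
    t = ‖∑ i, ∑ j, A i j * inner 𝕜 (x i) (x j)‖}

/-- The norm `‖A‖_Γ`, computed with vectors in `𝕜^d`: the maximum of
`|∑ i, ∑ j, a_ij ⟨x_i, x_j⟩|` over `x_1, …, x_n` in the closed unit ball of `𝕜^d`. -/
def GammaNorm (d : ℕ) (A : Matrix (Fin n) (Fin n) 𝕜) : ℝ :=
  sSup {t : ℝ | ∃ x : Fin n → EuclideanSpace 𝕜 (Fin d), (∀ i, ‖x i‖ ≤ 1) ∧
    t = ‖∑ i, ∑ j, A i j * inner 𝕜 (x i) (x j)‖}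

/-- The seminorm `‖A‖_θ`: the maximum of `|∑ i, ∑ j, a_ij conj(δ_i) δ_j|` over `|δ_i| = 1`. -/
def thetaNorm (A : Matrix (Fin n) (Fin n) 𝕜) : ℝ :=
  sSup {t : ℝ | ∃ δ : Fin n → 𝕜, (∀ i, ‖δ i‖ = 1) ∧
    t = ‖∑ i, ∑ j, A i j * (star (δ i) * δ j)‖}

/-- The norm `‖A‖_Θ`: the maximum of `|∑ i, ∑ j, a_ij conj(δ_i) δ_j|` over `|δ_i| ≤ 1`. -/
def ThetaNorm (A : Matrix (Fin n) (Fin n) 𝕜) : ℝ :=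
  sSup {t : ℝ | ∃ δ : Fin n → 𝕜, (∀ i, ‖δ i‖ ≤ 1) ∧
    t = ‖∑ i, ∑ j, A i j * (star (δ i) * δ j)‖}

variable (𝕜) in
/-- The symmetric Grothendieck constant `K_γ` over `𝕜`: the smallest `K` such that
`‖A‖_γ ≤ K ‖A‖_θ` for all `n`, all `d ≥ n` and all symmetric/Hermitian `n × n` matrices `A`. -/
def Kgamma : ℝ :=
  sInf {K : ℝ | ∀ n d : ℕ, n ≤ d → ∀ A : Matrix (Fin n) (Fin n) 𝕜, A.IsHermitian →
    gammaNorm d A ≤ K * thetaNorm A}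

variable (𝕜) in
/-- The symmetric Grothendieck constant `K_Γ` over `𝕜`: the smallest `K` such that
`‖A‖_Γ ≤ K ‖A‖_Θ` for all `n`, all `d ≥ n` and all symmetric/Hermitian `n × n` matrices `A`. -/
def KGamma : ℝ :=
  sInf {K : ℝ | ∀ n d : ℕ, n ≤ d → ∀ A : Matrix (Fin n) (Fin n) 𝕜, A.IsHermitian →
    GammaNorm d A ≤ K * ThetaNorm A}

/-- `q_=(A)`: the maximum of `x* A x` over vectors `x` with `|x_i| = 1` for all `i`.
(For Hermitian `A` the number `x* A x` is real, so taking the real part only changes its type.) -/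
def qEq (A : Matrix (Fin n) (Fin n) 𝕜) : ℝ :=
  sSup {t : ℝ | ∃ x : Fin n → 𝕜, (∀ i, ‖x i‖ = 1) ∧
    t = RCLike.re (star x ⬝ᵥ A.mulVec x)}

/-- `q_≤(A)`: the maximum of `x* A x` over vectors `x` with `|x_i| ≤ 1` for all `i`. -/
def qLe (A : Matrix (Fin n) (Fin n) 𝕜) : ℝ :=
  sSup {t : ℝ | ∃ x : Fin n → 𝕜, (∀ i, ‖x i‖ ≤ 1) ∧
    t = RCLike.re (star x ⬝ᵥ A.mulVec x)}

/-- `r_=(A)`: the maximum of `tr(AX)` over positive semidefinite `X` with `x_ii = 1` for all `i`.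
(For Hermitian `A`, `X` the number `tr(AX)` is real.) -/
def rEq (A : Matrix (Fin n) (Fin n) 𝕜) : ℝ :=
  sSup {t : ℝ | ∃ X : Matrix (Fin n) (Fin n) 𝕜, X.PosSemidef ∧ (∀ i, X i i = 1) ∧
    t = RCLike.re (A * X).trace}

/-- `r_≤(A)`: the maximum of `tr(AX)` over positive semidefinite `X` with `x_ii ≤ 1` for all `i`.
(The diagonal of a positive semidefinite matrix is real.) -/
def rLe (A : Matrix (Fin n) (Fin n) 𝕜) : ℝ :=
  sSup {t : ℝ | ∃ X : Matrix (Fin n) (Fin n) 𝕜, X.PosSemidef ∧ (∀ i, RCLike.re (X i i) ≤ 1) ∧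
    t = RCLike.re (A * X).trace}

end

end SymGrothendieck

open SymGrothendieck

/-!
Both lines are Grothendieck inequalities in disguise. Factoring a positive semidefinite matrix as a
Gram matrix turns `max (r A) (r (-A))` into the supremum of `|∑ a_ij ⟨u_i, u_j⟩|` over vectors
`u_i` in `𝕜^n`, and `max (q A) (q (-A))` is the same supremum over scalars. Since every Gram matrix
of `n` vectors is realised in `𝕜^n`, the dimensions `d ≥ n` in the definition of the constants all
give the same supremum. The set of admissible constants is closed and bounded below, so what
remains is that it is nonempty, as `sInf ∅ = 0`.

For the unit balls this is a truncation argument. Replacing `x ∈ 𝕜^n` by the random sum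
`∑ k, ω_k x_k` over signs `ω` preserves inner products, and by Khinchin's fourth moment inequality
such a sum is bounded by a constant up to an error that is small in `L²`. The bounded part is
controlled pointwise by the scalar supremum, and the error by a fraction of the vector supremum
itself, which can be absorbed.

For the unit spheres the diagonal of `A` contributes only the constant `Re tr A`. With zero
diagonal, `x ↦ x* A x` is affine in the real parameters along each coordinate direction, so its
extrema over the polydisc are attained on the torus, and the ball inequality applies.
-/

namespace SymGrothendieck

open Matrix

section QuadraticForm

variable {V : Type*} [AddCommGroup V] [Module ℝ V]

lemma quadraticForm_add_add_sub (Q : QuadraticForm ℝ V) (x y : V) :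
    Q (x + y) + Q (x - y) = 2 * Q x + 2 * Q y := by
  rw [sub_eq_add_neg, QuadraticMap.map_add Q x y, QuadraticMap.map_add Q x (-y), Q.map_neg,
    Q.polar_neg_right]
  ring

lemma quadraticForm_convex_combination (Q : QuadraticForm ℝ V) {a b : ℝ} (hab : a + b = 1)
    (x y : V) :
    Q (a • x + b • y) = a * Q x + b * Q y - a * b * Q (x - y) := by
  obtain rfl : b = 1 - a := by linarith
  rw [sub_eq_add_neg x, QuadraticMap.map_add Q (a • x), QuadraticMap.map_add Q x, Q.map_neg,
    Q.map_smul, Q.map_smul, Q.polar_smul_left, Q.polar_smul_right, Q.polar_neg_right]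
  simp only [smul_eq_mul]
  ring

lemma convexOn_quadraticForm_update {ι E : Type*} [DecidableEq ι] [AddCommGroup E] [Module ℝ E]
    (Q : QuadraticForm ℝ (ι → E)) {k : ι} (hQ : ∀ z, 0 ≤ Q (Pi.single k z)) (x : ι → E) :
    ConvexOn ℝ Set.univ fun v => Q (Function.update x k v) := by
  refine ⟨convex_univ, fun v _ w _ a b ha hb hab => ?_⟩
  have hcomb : Function.update x k (a • v + b • w)
      = a • Function.update x k v + b • Function.update x k w := by
    rw [← Function.update_smul, ← Function.update_smul, ← Function.update_add, ← add_smul, hab,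
      one_smul]
  have hdiff : Function.update x k v - Function.update x k w = Pi.single k (v - w) := by
    rw [← Function.update_sub, sub_self, Pi.single]
  have hsingle := mul_nonneg (mul_nonneg ha hb) (hQ (v - w))
  simp only [smul_eq_mul]
  rw [hcomb, quadraticForm_convex_combination Q hab, hdiff]
  linarith

end QuadraticForm

section BoundedQuadraticForm

variable {V : Type*} [NormedAddCommGroup V] [NormedSpace ℝ V] {Q : QuadraticForm ℝ V} {C : ℝ}

lemma abs_quadraticForm_le_mul_norm_sq (hC : ∀ x, ‖x‖ ≤ 1 → |Q x| ≤ C) (x : V) :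
    |Q x| ≤ C * ‖x‖ ^ 2 := by
  rcases eq_or_ne x 0 with rfl | hx
  · simp
  have hpos : 0 < ‖x‖ := norm_pos_iff.2 hx
  calc |Q x| = |Q (‖x‖ • ‖x‖⁻¹ • x)| := by rw [smul_inv_smul₀ hpos.ne']
    _ = ‖x‖ ^ 2 * |Q (‖x‖⁻¹ • x)| := by
      rw [Q.map_smul, smul_eq_mul, abs_mul, abs_mul_self, sq]
    _ ≤ ‖x‖ ^ 2 * C := by
      gcongr
      exact hC _ (by rw [norm_smul, norm_inv, norm_norm, inv_mul_cancel₀ hpos.ne'])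
    _ = C * ‖x‖ ^ 2 := mul_comm _ _

lemma abs_polar_le (hC : ∀ x, ‖x‖ ≤ 1 → |Q x| ≤ C) (x y : V) :
    |QuadraticMap.polar Q x y| ≤ 4 * C * ‖x‖ * ‖y‖ := by
  have hunit {x y : V} (hx : ‖x‖ = 1) (hy : ‖y‖ = 1) : |QuadraticMap.polar Q x y| ≤ 4 * C := by
    have hpolar : 2 * QuadraticMap.polar Q x y = Q (x + y) - Q (x - y) := by
      linarith [quadraticForm_add_add_sub Q x y, QuadraticMap.map_add Q x y]
    have hC0 : 0 ≤ C := (abs_nonneg _).trans (hC x hx.le)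
    have hball {z : V} (hz : ‖z‖ ≤ 2) : |Q z| ≤ 4 * C :=
      calc |Q z| ≤ C * ‖z‖ ^ 2 := abs_quadraticForm_le_mul_norm_sq hC z
        _ ≤ C * 2 ^ 2 := by gcongr
        _ = 4 * C := by ring
    have hadd := abs_le.1 (hball ((norm_add_le x y).trans (by linarith)))
    have hsub := abs_le.1 (hball ((norm_sub_le x y).trans (by linarith)))
    exact abs_le.2 ⟨by linarith, by linarith⟩
  rcases eq_or_ne x 0 with rfl | hx
  · simp
  rcases eq_or_ne y 0 with rfl | hy
  · simp
  have hx' := norm_ne_zero_iff.2 hx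
  have hy' := norm_ne_zero_iff.2 hy
  calc |QuadraticMap.polar Q x y|
      = |QuadraticMap.polar Q (‖x‖ • ‖x‖⁻¹ • x) (‖y‖ • ‖y‖⁻¹ • y)| := by
        rw [smul_inv_smul₀ hx', smul_inv_smul₀ hy']
    _ = ‖x‖ * ‖y‖ * |QuadraticMap.polar Q (‖x‖⁻¹ • x) (‖y‖⁻¹ • y)| := by
        rw [Q.polar_smul_left, Q.polar_smul_right, smul_eq_mul, smul_eq_mul, ← mul_assoc, abs_mul,
          abs_mul, abs_norm, abs_norm]
    _ ≤ ‖x‖ * ‖y‖ * (4 * C) := by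
        gcongr
        exact hunit (by rw [norm_smul, norm_inv, norm_norm, inv_mul_cancel₀ hx'])
          (by rw [norm_smul, norm_inv, norm_norm, inv_mul_cancel₀ hy'])
    _ = 4 * C * ‖x‖ * ‖y‖ := by ring

lemma abs_quadraticForm_add_le (hC : ∀ x, ‖x‖ ≤ 1 → |Q x| ≤ C) (x y : V) :
    |Q (x + y)| ≤ |Q x| + (4 * C * ‖x‖ * ‖y‖ + C * ‖y‖ ^ 2) :=
  calc |Q (x + y)| = |Q x + (QuadraticMap.polar Q x y + Q y)| := by
        rw [QuadraticMap.map_add Q x y, add_assoc, add_comm (Q y)]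
    _ ≤ |Q x| + (|QuadraticMap.polar Q x y| + |Q y|) :=
        (abs_add_le _ _).trans (by gcongr; exact abs_add_le _ _)
    _ ≤ |Q x| + (4 * C * ‖x‖ * ‖y‖ + C * ‖y‖ ^ 2) := by
        gcongr
        exacts [abs_polar_le hC x y, abs_quadraticForm_le_mul_norm_sq hC y]

end BoundedQuadraticForm

section MaximumPrinciple

variable {ι E : Type*} [Finite ι] [DecidableEq ι] [NormedAddCommGroup E] [NormedSpace ℝ E]
  [Nontrivial E] {f : (ι → E) → ℝ}

lemma exists_norm_eq_one_le_of_separately_convex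
    (hf : ∀ x k, ConvexOn ℝ Set.univ fun v => f (Function.update x k v))
    {x : ι → E} (hx : ∀ i, ‖x i‖ ≤ 1) : ∃ y, (∀ i, ‖y i‖ = 1) ∧ f x ≤ f y := by
  cases nonempty_fintype ι
  have hmax {g : E → ℝ} (hg : ConvexOn ℝ Set.univ g) {v : E} (hv : ‖v‖ ≤ 1) :
      ∃ w, ‖w‖ = 1 ∧ g v ≤ g w := by
    have hmem : v ∈ convexHull ℝ (Metric.sphere (0 : E) 1) := by
      rwa [convexHull_sphere_eq_closedBall 0 zero_le_one, mem_closedBall_zero_iff]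
    obtain ⟨w, hw, hle⟩ := hg.exists_ge_of_mem_convexHull (Set.subset_univ _) hmem
    exact ⟨w, mem_sphere_zero_iff_norm.1 hw, hle⟩
  suffices h : ∀ s : Finset ι, ∃ y, (∀ i ∈ s, ‖y i‖ = 1) ∧ (∀ i, ‖y i‖ ≤ 1) ∧ f x ≤ f y by
    obtain ⟨y, hy, -, hle⟩ := h Finset.univ
    exact ⟨y, fun i => hy i (Finset.mem_univ i), hle⟩
  intro s
  induction s using Finset.induction_on with
  | empty => exact ⟨x, by simp, hx, le_rfl⟩
  | insert k s _ ih =>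
    obtain ⟨y, hy, hy_le, hxy⟩ := ih
    obtain ⟨w, hw, hyw⟩ := hmax (hf y k) (hy_le k)
    rw [Function.update_eq_self] at hyw
    refine ⟨Function.update y k w, fun i hi => ?_, fun i => ?_, hxy.trans hyw⟩
    · rcases eq_or_ne i k with rfl | hik
      · rwa [Function.update_self]
      · rw [Function.update_of_ne hik]
        exact hy i (Finset.mem_of_mem_insert_of_ne hi hik)
    · rcases eq_or_ne i k with rfl | hik
      · rw [Function.update_self, hw]
      · rw [Function.update_of_ne hik]
        exact hy_le i

end MaximumPrinciple

section Signs

variable {ι E : Type*} [Fintype ι] [DecidableEq ι] [AddCommGroup E]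

lemma two_mul_sum_signs_insert (F : E → ℝ) (x : ι → E) {s : Finset ι} {k : ι} (hk : k ∉ s) :
    2 * ∑ ω : ι → ℤˣ, F (∑ l ∈ insert k s, ω l • x l)
      = ∑ ω : ι → ℤˣ, (F (∑ l ∈ s, ω l • x l + x k) + F (∑ l ∈ s, ω l • x l - x k)) := by
  let flip : ι → ℤˣ := Pi.mulSingle k (-1)
  have hflip (ω : ι → ℤˣ) : ∑ l ∈ insert k s, (flip * ω) l • x l
      = ∑ l ∈ s, ω l • x l - ω k • x k := by
    rw [Finset.sum_insert hk, sub_eq_neg_add]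
    congr 1
    · simp [flip, Units.smul_def]
    · refine Finset.sum_congr rfl fun l hl => ?_
      have : l ≠ k := fun h => hk (h ▸ hl)
      simp [flip, this]
  calc 2 * ∑ ω : ι → ℤˣ, F (∑ l ∈ insert k s, ω l • x l)
      = ∑ ω : ι → ℤˣ, F (∑ l ∈ insert k s, ω l • x l)
          + ∑ ω : ι → ℤˣ, F (∑ l ∈ insert k s, (flip * ω) l • x l) := by
        rw [two_mul]
        exact congrArg _ (Equiv.sum_comp (Equiv.mulLeft flip)
          fun ω : ι → ℤˣ => F (∑ l ∈ insert k s, ω l • x l)).symm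
    _ = ∑ ω : ι → ℤˣ, (F (∑ l ∈ s, ω l • x l + x k) + F (∑ l ∈ s, ω l • x l - x k)) := by
        rw [← Finset.sum_add_distrib]
        refine Finset.sum_congr rfl fun ω _ => ?_
        rw [hflip, Finset.sum_insert hk, add_comm (ω k • x k)]
        rcases Int.units_eq_one_or (ω k) with h | h
        · rw [h, one_smul]
        · rw [h, Units.neg_smul, one_smul, ← sub_eq_add_neg, sub_neg_eq_add, add_comm]

lemma sum_signs_of_parallelogram_law {F : E → ℝ}
    (hF : ∀ a b, F (a + b) + F (a - b) = 2 * F a + 2 * F b) (x : ι → E) (s : Finset ι) :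
    ∑ ω : ι → ℤˣ, F (∑ k ∈ s, ω k • x k) = Fintype.card (ι → ℤˣ) * ∑ k ∈ s, F (x k) := by
  induction s using Finset.induction_on with
  | empty =>
    have hF0 : F 0 = 0 := by
      have := hF 0 0
      rw [add_zero, sub_zero] at this
      linarith
    simp [hF0]
  | insert k s hk ih =>
    have h := two_mul_sum_signs_insert F x hk
    simp only [hF, Finset.sum_add_distrib, ← Finset.mul_sum, ih, Finset.sum_const,
      Finset.card_univ, nsmul_eq_mul] at h
    rw [Finset.sum_insert hk]
    linarith

end Signs

section Khinchin

variable (𝕜 : Type*) {ι E : Type*} [RCLike 𝕜] [Fintype ι] [DecidableEq ι] [NormedAddCommGroup E]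
  [InnerProductSpace 𝕜 E]

include 𝕜 in
lemma norm_add_pow_four_add_norm_sub_pow_four_le (a b : E) :
    ‖a + b‖ ^ 4 + ‖a - b‖ ^ 4 ≤ 2 * ‖a‖ ^ 4 + 12 * ‖a‖ ^ 2 * ‖b‖ ^ 2 + 2 * ‖b‖ ^ 4 := by
  set r := RCLike.re (inner 𝕜 a b)
  have hr : r ^ 2 ≤ ‖a‖ ^ 2 * ‖b‖ ^ 2 := by
    rw [← mul_pow, sq_le_sq, abs_of_nonneg (by positivity : 0 ≤ ‖a‖ * ‖b‖)]
    exact (RCLike.abs_re_le_norm _).trans (norm_inner_le_norm a b)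
  calc ‖a + b‖ ^ 4 + ‖a - b‖ ^ 4 = (‖a + b‖ ^ 2) ^ 2 + (‖a - b‖ ^ 2) ^ 2 := by ring
    _ = 2 * ‖a‖ ^ 4 + 4 * ‖a‖ ^ 2 * ‖b‖ ^ 2 + 2 * ‖b‖ ^ 4 + 8 * r ^ 2 := by
      rw [norm_add_sq (𝕜 := 𝕜), norm_sub_sq (𝕜 := 𝕜)]
      ring
    _ ≤ _ := by linarith

include 𝕜 in
lemma sum_signs_norm_sq (x : ι → E) (s : Finset ι) :
    ∑ ω : ι → ℤˣ, ‖∑ k ∈ s, ω k • x k‖ ^ 2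
      = Fintype.card (ι → ℤˣ) * ∑ k ∈ s, ‖x k‖ ^ 2 :=
  sum_signs_of_parallelogram_law (F := fun a : E => ‖a‖ ^ 2)
    (fun a b => by linarith [parallelogram_law_with_norm 𝕜 a b]) x s

include 𝕜 in
lemma sum_signs_norm_pow_four_le (x : ι → E) (s : Finset ι) :
    ∑ ω : ι → ℤˣ, ‖∑ k ∈ s, ω k • x k‖ ^ 4
      ≤ 3 * Fintype.card (ι → ℤˣ) * (∑ k ∈ s, ‖x k‖ ^ 2) ^ 2 := by
  induction s using Finset.induction_on with
  | empty => simp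
  | insert k s hk ih =>
    have hsq := sum_signs_norm_sq 𝕜 x s
    set N : ℝ := (Fintype.card (ι → ℤˣ) : ℝ)
    set σ := ∑ l ∈ s, ‖x l‖ ^ 2
    rw [Finset.sum_insert hk]
    refine le_of_mul_le_mul_left ?_ two_pos
    calc 2 * ∑ ω : ι → ℤˣ, ‖∑ l ∈ insert k s, ω l • x l‖ ^ 4
        ≤ ∑ ω : ι → ℤˣ, (2 * ‖∑ l ∈ s, ω l • x l‖ ^ 4
            + 12 * ‖∑ l ∈ s, ω l • x l‖ ^ 2 * ‖x k‖ ^ 2 + 2 * ‖x k‖ ^ 4) := by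
          rw [two_mul_sum_signs_insert (fun a : E => ‖a‖ ^ 4) x hk]
          exact Finset.sum_le_sum fun ω _ => norm_add_pow_four_add_norm_sub_pow_four_le 𝕜 _ _
      _ = 2 * ∑ ω : ι → ℤˣ, ‖∑ l ∈ s, ω l • x l‖ ^ 4 + 12 * (N * σ) * ‖x k‖ ^ 2
            + N * (2 * ‖x k‖ ^ 4) := by
          simp only [Finset.sum_add_distrib, ← Finset.mul_sum, ← Finset.sum_mul, hsq,
            Finset.sum_const, Finset.card_univ, nsmul_eq_mul, N]
          ring
      _ ≤ 2 * (3 * N * σ ^ 2) + 12 * (N * σ) * ‖x k‖ ^ 2 + N * (6 * ‖x k‖ ^ 4) := by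
          gcongr
          norm_num
      _ = 2 * (3 * N * (‖x k‖ ^ 2 + σ) ^ 2) := by ring

end Khinchin

section GramForm

variable {𝕜 ι E : Type*} [RCLike 𝕜] [Fintype ι] [NormedAddCommGroup E] [InnerProductSpace 𝕜 E]
  [NormedSpace ℝ E] [IsScalarTower ℝ 𝕜 E] {A : Matrix ι ι 𝕜}

variable (E) in
/-- The real quadratic form `u ↦ Re (∑ i, ∑ j, a_ij ⟨u_i, u_j⟩)` on families of vectors in `E`,
that is `u ↦ Re tr (A Gᵀ)` with `G` the Gram matrix of `u`. It is `x ↦ Re (x* A x)` for `E = 𝕜`. -/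
noncomputable def gramForm (A : Matrix ι ι 𝕜) : QuadraticForm ℝ (ι → E) :=
  LinearMap.BilinMap.toQuadraticMap <|
  LinearMap.mk₂ ℝ (fun u v : ι → E => RCLike.re (∑ i, ∑ j, A i j * inner 𝕜 (u i) (v j)))
    (fun u v w => by
      simp only [Pi.add_apply, inner_add_left, mul_add, Finset.sum_add_distrib, map_add])
    (fun r u v => by
      simp only [Pi.smul_apply, inner_smul_left_eq_smul, mul_smul_comm, ← Finset.smul_sum,
        RCLike.smul_re, smul_eq_mul])
    (fun u v w => by
      simp only [Pi.add_apply, inner_add_right, mul_add, Finset.sum_add_distrib, map_add])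
    (fun r u v => by
      simp only [Pi.smul_apply, inner_smul_right_eq_smul, mul_smul_comm, ← Finset.smul_sum,
        RCLike.smul_re, smul_eq_mul])

lemma gramForm_apply (A : Matrix ι ι 𝕜) (u : ι → E) :
    gramForm E A u = RCLike.re (∑ i, ∑ j, A i j * inner 𝕜 (u i) (u j)) := rfl

lemma gramForm_neg (A : Matrix ι ι 𝕜) (u : ι → E) : gramForm E (-A) u = -gramForm E A u := by
  simp only [gramForm_apply, Matrix.neg_apply, neg_mul, Finset.sum_neg_distrib, map_neg]

lemma gramForm_sub (A B : Matrix ι ι 𝕜) (u : ι → E) :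
    gramForm E (A - B) u = gramForm E A u - gramForm E B u := by
  simp only [gramForm_apply, Matrix.sub_apply, sub_mul, Finset.sum_sub_distrib, map_sub]

lemma gramForm_diagonal [DecidableEq ι] (d : ι → 𝕜) (u : ι → E) :
    gramForm E (diagonal d) u = ∑ i, RCLike.re (d i) * ‖u i‖ ^ 2 := by
  simp only [gramForm_apply, diagonal_apply, ite_mul, zero_mul, Finset.sum_ite_eq,
    Finset.mem_univ, if_true, map_sum, inner_self_eq_norm_sq_to_K]
  norm_cast
  simp only [RCLike.re_mul_ofReal]

lemma gramForm_single [DecidableEq ι] (A : Matrix ι ι 𝕜) (k : ι) (z : E) :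
    gramForm E A (Pi.single k z) = RCLike.re (A k k) * ‖z‖ ^ 2 := by
  rw [gramForm_apply, Finset.sum_eq_single k (fun i _ hi => by simp [Pi.single_eq_of_ne hi])
    (by simp), Finset.sum_eq_single k (fun j _ hj => by simp [Pi.single_eq_of_ne hj]) (by simp),
    Pi.single_eq_same, inner_self_eq_norm_sq_to_K]
  norm_cast
  rw [RCLike.re_mul_ofReal]

lemma abs_gramForm_le_sum_norm (A : Matrix ι ι 𝕜) {u : ι → E} (hu : ∀ i, ‖u i‖ ≤ 1) :
    |gramForm E A u| ≤ ∑ i, ∑ j, ‖A i j‖ :=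
  calc |gramForm E A u| ≤ ‖∑ i, ∑ j, A i j * inner 𝕜 (u i) (u j)‖ := RCLike.abs_re_le_norm _
    _ ≤ ∑ i, ∑ j, ‖A i j * inner 𝕜 (u i) (u j)‖ :=
      (norm_sum_le _ _).trans (Finset.sum_le_sum fun i _ => norm_sum_le _ _)
    _ ≤ ∑ i, ∑ j, ‖A i j‖ := by
      gcongr with i _ j _
      rw [norm_mul]
      refine mul_le_of_le_one_right (norm_nonneg _) ((norm_inner_le_norm _ _).trans ?_)
      exact mul_le_one₀ (hu i) (norm_nonneg _) (hu j)

lemma gramForm_euclidean {κ : Type*} [Fintype κ] (A : Matrix ι ι 𝕜)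
    (u : ι → EuclideanSpace 𝕜 κ) :
    gramForm (EuclideanSpace 𝕜 κ) A u = ∑ l, gramForm 𝕜 A fun i => u i l := by
  simp only [gramForm_apply, PiLp.inner_apply, Finset.mul_sum, map_sum]
  rw [Finset.sum_comm_cycle]

lemma norm_sum_mul_inner_eq_abs_gramForm (hA : A.IsHermitian) (u : ι → E) :
    ‖∑ i, ∑ j, A i j * inner 𝕜 (u i) (u j)‖ = |gramForm E A u| := by
  have hreal : (starRingEnd 𝕜) (∑ i, ∑ j, A i j * inner 𝕜 (u i) (u j))
      = ∑ i, ∑ j, A i j * inner 𝕜 (u i) (u j) := by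
    simp only [map_sum, map_mul, inner_conj_symm]
    rw [Finset.sum_comm]
    simp only [starRingEnd_apply, hA.apply]
  rw [gramForm_apply, ← RCLike.norm_ofReal (K := 𝕜), RCLike.conj_eq_iff_re.1 hreal]

end GramForm

section Gram

open scoped MatrixOrder Matrix.Norms.L2Operator in
lemma exists_gram_eq {𝕜 ι : Type*} [RCLike 𝕜] [Fintype ι] {X : Matrix ι ι 𝕜}
    (hX : X.PosSemidef) : ∃ v : ι → EuclideanSpace 𝕜 ι, gram 𝕜 v = X := by
  classical
  obtain ⟨B, rfl⟩ := CStarAlgebra.nonneg_iff_eq_star_mul_self.1 hX.nonneg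
  refine ⟨fun i => WithLp.toLp 2 fun k => B k i, ?_⟩
  ext i j
  simp only [gram_apply, PiLp.inner_apply, RCLike.inner_apply, Matrix.mul_apply,
    Matrix.star_apply, mul_comm, RCLike.star_def]

variable {𝕜 ι E : Type*} [RCLike 𝕜] [NormedAddCommGroup E] [InnerProductSpace 𝕜 E]

lemma exists_euclidean_gram_eq [Fintype ι] (u : ι → E) :
    ∃ v : ι → EuclideanSpace 𝕜 ι, gram 𝕜 v = gram 𝕜 u :=
  exists_gram_eq (posSemidef_gram 𝕜 u)

lemma norm_eq_of_gram_eq {F : Type*} [NormedAddCommGroup F] [InnerProductSpace 𝕜 F] {u : ι → E}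
    {v : ι → F} (h : gram 𝕜 u = gram 𝕜 v) (i : ι) : ‖u i‖ = ‖v i‖ := by
  have hinner : inner 𝕜 (u i) (u i) = inner 𝕜 (v i) (v i) := congrFun (congrFun h i) i
  rw [norm_eq_sqrt_re_inner (𝕜 := 𝕜), hinner, ← norm_eq_sqrt_re_inner]

lemma gramForm_eq_re_trace [Fintype ι] [NormedSpace ℝ E] [IsScalarTower ℝ 𝕜 E]
    (A : Matrix ι ι 𝕜) (u : ι → E) :
    gramForm E A u = RCLike.re (A * (gram 𝕜 u)ᵀ).trace := rfl

end Gram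

section Rademacher

variable {𝕜 κ : Type*} [RCLike 𝕜] [Fintype κ] [DecidableEq κ]

/-- The function `ω ↦ ∑ k, ω_k x_k` on the sign vectors `ω`. Up to the factor `√(2 ^ |κ|)` it is an
isometric embedding of `𝕜^κ` into `ℓ²` of the cube whose image has comparable `ℓ²` and `ℓ⁴`
norms (Khinchin's inequality). -/
noncomputable def rademacher (x : EuclideanSpace 𝕜 κ) : EuclideanSpace 𝕜 (κ → ℤˣ) :=
  WithLp.toLp 2 fun ω => ∑ k, ω k • x k

lemma norm_rademacher_sq (x : EuclideanSpace 𝕜 κ) :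
    ‖rademacher x‖ ^ 2 = Fintype.card (κ → ℤˣ) * ‖x‖ ^ 2 := by
  rw [EuclideanSpace.norm_sq_eq, EuclideanSpace.norm_sq_eq]
  exact sum_signs_norm_sq 𝕜 (fun k => x k) Finset.univ

lemma norm_rademacher_le {x : EuclideanSpace 𝕜 κ}
    (hx : ‖x‖ ≤ 1) : ‖rademacher x‖ ≤ √(Fintype.card (κ → ℤˣ)) := by
  refine Real.le_sqrt_of_sq_le ?_
  rw [norm_rademacher_sq]
  exact mul_le_of_le_one_right (Nat.cast_nonneg _) (pow_le_one₀ (norm_nonneg _) hx)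

lemma sum_norm_rademacher_pow_four_le (x : EuclideanSpace 𝕜 κ) :
    ∑ ω, ‖rademacher x ω‖ ^ 4 ≤ 3 * Fintype.card (κ → ℤˣ) * ‖x‖ ^ 4 := by
  rw [show ‖x‖ ^ 4 = (‖x‖ ^ 2) ^ 2 by ring, EuclideanSpace.norm_sq_eq]
  exact sum_signs_norm_pow_four_le 𝕜 (fun k => x k) Finset.univ

lemma gramForm_rademacher {ι : Type*} [Fintype ι] (A : Matrix ι ι 𝕜)
    (u : ι → EuclideanSpace 𝕜 κ) :
    gramForm (EuclideanSpace 𝕜 (κ → ℤˣ)) A (fun i => rademacher (u i))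
      = Fintype.card (κ → ℤˣ) * gramForm (EuclideanSpace 𝕜 κ) A u := by
  have hcoord (ω : κ → ℤˣ) : (fun i => rademacher (u i) ω) = ∑ k, ω k • fun i => u i k := by
    ext i
    simp [rademacher]
  simp only [gramForm_euclidean, hcoord]
  exact sum_signs_of_parallelogram_law (quadraticForm_add_add_sub (gramForm 𝕜 A))
    (fun k i => u i k) Finset.univ

end Rademacher

section Truncation

variable {𝕜 Ω : Type*} [RCLike 𝕜] {M : ℝ}

open Classical in
/-- The truncation of the function `f` at height `M`: values of norm larger than `M` are replaced
by `0`. -/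
noncomputable def truncate (M : ℝ) (f : EuclideanSpace 𝕜 Ω) : EuclideanSpace 𝕜 Ω :=
  WithLp.toLp 2 fun ω => if ‖f ω‖ ≤ M then f ω else 0

lemma norm_truncate_apply_le (hM : 0 ≤ M) (f : EuclideanSpace 𝕜 Ω) (ω : Ω) :
    ‖truncate M f ω‖ ≤ M := by
  by_cases h : ‖f ω‖ ≤ M <;> simp [truncate, h, hM]

variable [Fintype Ω]

lemma norm_truncate_le (M : ℝ) (f : EuclideanSpace 𝕜 Ω) : ‖truncate M f‖ ≤ ‖f‖ := by
  rw [EuclideanSpace.norm_eq, EuclideanSpace.norm_eq]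
  gcongr with ω
  by_cases h : ‖f ω‖ ≤ M <;> simp [truncate, h]

lemma sq_mul_norm_sub_truncate_sq_le (hM : 0 ≤ M) (f : EuclideanSpace 𝕜 Ω) :
    M ^ 2 * ‖f - truncate M f‖ ^ 2 ≤ ∑ ω, ‖f ω‖ ^ 4 := by
  rw [EuclideanSpace.norm_sq_eq, Finset.mul_sum]
  gcongr with ω
  by_cases h : ‖f ω‖ ≤ M
  · simp [truncate, h]
  · calc M ^ 2 * ‖(f - truncate M f) ω‖ ^ 2 = M ^ 2 * ‖f ω‖ ^ 2 := by simp [truncate, h]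
      _ ≤ ‖f ω‖ ^ 2 * ‖f ω‖ ^ 2 := by gcongr; exact (not_le.1 h).le
      _ = ‖f ω‖ ^ 4 := by ring

lemma norm_rademacher_sub_truncate_le {κ : Type*} [Fintype κ] [DecidableEq κ]
    {x : EuclideanSpace 𝕜 κ} (hx : ‖x‖ ≤ 1) :
    ‖rademacher x - truncate 14 (rademacher x)‖ ≤ √(Fintype.card (κ → ℤˣ)) / 8 := by
  have hfour : 14 ^ 2 * ‖rademacher x - truncate 14 (rademacher x)‖ ^ 2
      ≤ 3 * Fintype.card (κ → ℤˣ) :=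
    calc 14 ^ 2 * ‖rademacher x - truncate 14 (rademacher x)‖ ^ 2
        ≤ ∑ ω, ‖rademacher x ω‖ ^ 4 := sq_mul_norm_sub_truncate_sq_le (by norm_num) _
      _ ≤ 3 * Fintype.card (κ → ℤˣ) * ‖x‖ ^ 4 := sum_norm_rademacher_pow_four_le x
      _ ≤ 3 * Fintype.card (κ → ℤˣ) :=
        mul_le_of_le_one_right (by positivity) (pow_le_one₀ (norm_nonneg _) hx)
  -- the height 14 is chosen so that `3 / 14 ^ 2 ≤ 1 / 8 ^ 2`
  refine le_of_sq_le_sq ?_ (by positivity)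
  rw [div_pow, Real.sq_sqrt (Nat.cast_nonneg _)]
  linarith

end Truncation

section GramNorm

variable {𝕜 ι : Type*} [RCLike 𝕜] [Fintype ι] {A : Matrix ι ι 𝕜} {c : ℝ} {s : Set ℝ} {E : Type*}
  [NormedAddCommGroup E] [InnerProductSpace 𝕜 E] [NormedSpace ℝ E] [IsScalarTower ℝ 𝕜 E]

variable (s E) in
/-- The supremum of `|Re (∑ i, ∑ j, a_ij ⟨u_i, u_j⟩)|` over vectors `u_i ∈ E` with `‖u_i‖ ∈ s`. The
choices `s = {1}` and `s = Set.Iic 1` give the norms `‖A‖_γ` and `‖A‖_Γ` of a Hermitian matrix when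
`E` is a Euclidean space, and its norms `‖A‖_θ` and `‖A‖_Θ` when `E = 𝕜`. -/
noncomputable def gramNorm (A : Matrix ι ι 𝕜) : ℝ :=
  ⨆ u : {u : ι → E // ∀ i, ‖u i‖ ∈ s}, |gramForm E A u|

lemma gramNorm_nonneg (s : Set ℝ) (A : Matrix ι ι 𝕜) : 0 ≤ gramNorm s E A :=
  Real.iSup_nonneg fun _ => abs_nonneg _

lemma gramNorm_le (hc : 0 ≤ c) (h : ∀ u : ι → E, (∀ i, ‖u i‖ ∈ s) → |gramForm E A u| ≤ c) :
    gramNorm s E A ≤ c :=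
  Real.iSup_le (fun u => h u u.2) hc

lemma abs_gramForm_le_gramNorm (hs : s ⊆ Set.Iic 1) (A : Matrix ι ι 𝕜) {u : ι → E}
    (hu : ∀ i, ‖u i‖ ∈ s) : |gramForm E A u| ≤ gramNorm s E A :=
  le_ciSup (f := fun u : {u : ι → E // ∀ i, ‖u i‖ ∈ s} => |gramForm E A u|)
    ⟨∑ i, ∑ j, ‖A i j‖, by
      rintro _ ⟨v, rfl⟩
      exact abs_gramForm_le_sum_norm A fun i => hs (v.2 i)⟩ ⟨u, hu⟩

lemma gramNorm_le_gramNorm_euclideanSpace (hs : s ⊆ Set.Iic 1)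
    (A : Matrix ι ι 𝕜) : gramNorm s E A ≤ gramNorm s (EuclideanSpace 𝕜 ι) A := by
  refine gramNorm_le (gramNorm_nonneg s A) fun u hu => ?_
  obtain ⟨v, hv⟩ := exists_euclidean_gram_eq (𝕜 := 𝕜) u
  rw [gramForm_eq_re_trace, ← hv, ← gramForm_eq_re_trace]
  exact abs_gramForm_le_gramNorm hs A fun i => norm_eq_of_gram_eq hv i ▸ hu i

end GramNorm

section Grothendieck

variable {𝕜 ι : Type*} [RCLike 𝕜] [Fintype ι] {A : Matrix ι ι 𝕜} {c C : ℝ}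

lemma abs_gramForm_le_of_norm_apply_le {Ω : Type*} [Fintype Ω] {M : ℝ} (hM : 0 ≤ M)
    {u : ι → EuclideanSpace 𝕜 Ω} (hu : ∀ i ω, ‖u i ω‖ ≤ M) :
    |gramForm (EuclideanSpace 𝕜 Ω) A u|
      ≤ Fintype.card Ω * (gramNorm (Set.Iic 1) 𝕜 A * M ^ 2) := by
  have hball (x : ι → 𝕜) (hx : ‖x‖ ≤ 1) : |gramForm 𝕜 A x| ≤ gramNorm (Set.Iic 1) 𝕜 A :=
    abs_gramForm_le_gramNorm subset_rfl A fun i => (norm_le_pi_norm x i).trans hx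
  rw [gramForm_euclidean]
  calc |∑ ω, gramForm 𝕜 A fun i => u i ω| ≤ ∑ ω, |gramForm 𝕜 A fun i => u i ω| :=
        Finset.abs_sum_le_sum_abs _ _
    _ ≤ ∑ _ω : Ω, gramNorm (Set.Iic 1) 𝕜 A * M ^ 2 := by
        gcongr with ω
        refine (abs_quadraticForm_le_mul_norm_sq hball _).trans ?_
        gcongr
        · exact gramNorm_nonneg _ _
        · exact (pi_norm_le_iff_of_nonneg hM).2 fun i => hu i ω
    _ = Fintype.card Ω * (gramNorm (Set.Iic 1) 𝕜 A * M ^ 2) := by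
        rw [Finset.sum_const, Finset.card_univ, nsmul_eq_mul]

lemma abs_gramForm_le_of_forall_cube {κ : Type*} [Fintype κ] [DecidableEq κ]
    {u : ι → EuclideanSpace 𝕜 κ} (hu : ∀ i, ‖u i‖ ≤ 1)
    (hC : ∀ v : ι → EuclideanSpace 𝕜 (κ → ℤˣ), ‖v‖ ≤ 1 → |gramForm _ A v| ≤ C) :
    |gramForm _ A u| ≤ 196 * gramNorm (Set.Iic 1) 𝕜 A + 33 / 64 * C := by
  set c := gramNorm (Set.Iic 1) 𝕜 A
  set N : ℝ := (Fintype.card (κ → ℤˣ) : ℝ)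
  have hN : 0 < N := Nat.cast_pos.2 Fintype.card_pos
  have hC0 : 0 ≤ C := (abs_nonneg _).trans (hC 0 (by simp))
  let f : ι → EuclideanSpace 𝕜 (κ → ℤˣ) := fun i => rademacher (u i)
  let t : ι → EuclideanSpace 𝕜 (κ → ℤˣ) := fun i => truncate 14 (f i)
  have ht : ‖t‖ ≤ √N := (pi_norm_le_iff_of_nonneg (by positivity)).2 fun i =>
    (norm_truncate_le _ _).trans (norm_rademacher_le (hu i))
  have hft : ‖f - t‖ ≤ √N / 8 := (pi_norm_le_iff_of_nonneg (by positivity)).2 fun i =>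
    norm_rademacher_sub_truncate_le (hu i)
  have hQt : |gramForm _ A t| ≤ N * (c * 14 ^ 2) :=
    abs_gramForm_le_of_norm_apply_le (by norm_num) fun i ω =>
      norm_truncate_apply_le (by norm_num) (f i) ω
  refine le_of_mul_le_mul_left ?_ hN
  calc N * |gramForm _ A u| = |gramForm _ A (t + (f - t))| := by
        rw [add_sub_cancel, gramForm_rademacher, abs_mul, abs_of_pos hN]
    _ ≤ |gramForm _ A t| + (4 * C * ‖t‖ * ‖f - t‖ + C * ‖f - t‖ ^ 2) :=
        abs_quadraticForm_add_le hC t (f - t)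
    _ ≤ N * (c * 14 ^ 2) + (4 * C * √N * (√N / 8) + C * (√N / 8) ^ 2) := by gcongr
    _ = N * (196 * c + 33 / 64 * C) := by
        linear_combination (33 / 64 * C) * Real.sq_sqrt hN.le

variable {E : Type*} [NormedAddCommGroup E] [InnerProductSpace 𝕜 E] [NormedSpace ℝ E]
  [IsScalarTower ℝ 𝕜 E]

lemma gramNorm_Iic_le_mul_scalar (A : Matrix ι ι 𝕜) :
    gramNorm (Set.Iic 1) E A ≤ 405 * gramNorm (Set.Iic 1) 𝕜 A := by
  classical
  set c := gramNorm (Set.Iic 1) 𝕜 A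
  set C := gramNorm (Set.Iic 1) (EuclideanSpace 𝕜 ι) A
  have hc : 0 ≤ c := gramNorm_nonneg _ A
  have hC : 0 ≤ C := gramNorm_nonneg _ A
  have hself : C ≤ 196 * c + 33 / 64 * C :=
    gramNorm_le (by positivity) fun u hu => abs_gramForm_le_of_forall_cube hu fun v hv =>
      (abs_gramForm_le_gramNorm subset_rfl A fun i => (norm_le_pi_norm v i).trans hv).trans
        (gramNorm_le_gramNorm_euclideanSpace subset_rfl A)
  calc gramNorm (Set.Iic 1) E A ≤ C := gramNorm_le_gramNorm_euclideanSpace subset_rfl A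
    _ ≤ 405 * c := by linarith

end Grothendieck

section Sphere

/-- The matrix `A` with its diagonal replaced by `0`. -/
def offDiag {R ι : Type*} [AddGroup R] [DecidableEq ι] (A : Matrix ι ι R) : Matrix ι ι R :=
  A - diagonal A.diag

lemma offDiag_apply_self {R ι : Type*} [AddGroup R] [DecidableEq ι] (A : Matrix ι ι R) (i : ι) :
    offDiag A i i = 0 := by
  simp only [offDiag, Matrix.sub_apply, diagonal_apply_eq, diag_apply, sub_self]

variable {𝕜 ι E : Type*} [RCLike 𝕜] [Fintype ι] [NormedAddCommGroup E] [InnerProductSpace 𝕜 E]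
  [NormedSpace ℝ E] [IsScalarTower ℝ 𝕜 E]

lemma exists_norm_eq_one_gramForm_le [Nontrivial E] {A : Matrix ι ι 𝕜}
    (hA : ∀ i, 0 ≤ RCLike.re (A i i)) {u : ι → E} (hu : ∀ i, ‖u i‖ ≤ 1) :
    ∃ v : ι → E, (∀ i, ‖v i‖ = 1) ∧ gramForm E A u ≤ gramForm E A v := by
  classical
  refine exists_norm_eq_one_le_of_separately_convex (fun x k => ?_) hu
  refine convexOn_quadraticForm_update _ (fun z => ?_) x
  rw [gramForm_single]
  exact mul_nonneg (hA k) (sq_nonneg _)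

lemma gramForm_offDiag_add_trace [DecidableEq ι] (A : Matrix ι ι 𝕜) {u : ι → E}
    (hu : ∀ i, ‖u i‖ = 1) :
    gramForm E (offDiag A) u + RCLike.re A.trace = gramForm E A u := by
  simp [offDiag, gramForm_sub, gramForm_diagonal, hu, Matrix.trace]

lemma abs_gramForm_offDiag_add_trace_le [DecidableEq ι] (A : Matrix ι ι 𝕜) {x : ι → 𝕜}
    (hx : ∀ i, ‖x i‖ ≤ 1) :
    |gramForm 𝕜 (offDiag A) x + RCLike.re A.trace| ≤ gramNorm {1} 𝕜 A := by
  have hle {y : ι → 𝕜} (hy : ∀ i, ‖y i‖ = 1) :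
      |gramForm 𝕜 (offDiag A) y + RCLike.re A.trace| ≤ gramNorm {1} 𝕜 A := by
    rw [gramForm_offDiag_add_trace A hy]
    exact abs_gramForm_le_gramNorm (by simp) A hy
  obtain ⟨y, hy, hxy⟩ :=
    exists_norm_eq_one_gramForm_le (A := offDiag A) (by simp [offDiag_apply_self]) hx
  obtain ⟨z, hz, hxz⟩ :=
    exists_norm_eq_one_gramForm_le (A := -offDiag A) (by simp [offDiag_apply_self]) hx
  rw [gramForm_neg, gramForm_neg, neg_le_neg_iff] at hxz
  have hupper := (abs_le.1 (hle hy)).2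
  have hlower := (abs_le.1 (hle hz)).1
  exact abs_le.2 ⟨by linarith, by linarith⟩

lemma gramNorm_singleton_le_mul_scalar (A : Matrix ι ι 𝕜) :
    gramNorm {1} E A ≤ 811 * gramNorm {1} 𝕜 A := by
  classical
  set c := gramNorm {1} 𝕜 A
  have hc : 0 ≤ c := gramNorm_nonneg _ A
  have htrace : |RCLike.re A.trace| ≤ c := by
    simpa using abs_gramForm_offDiag_add_trace_le A (x := 0) (by simp)
  have hoff : gramNorm (Set.Iic 1) 𝕜 (offDiag A) ≤ 2 * c := by
    refine gramNorm_le (by positivity) fun x hx => ?_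
    calc |gramForm 𝕜 (offDiag A) x|
        = |gramForm 𝕜 (offDiag A) x + RCLike.re A.trace - RCLike.re A.trace| := by
          rw [add_sub_cancel_right]
      _ ≤ c + c := (abs_sub _ _).trans
          (add_le_add (abs_gramForm_offDiag_add_trace_le A hx) htrace)
      _ = 2 * c := (two_mul c).symm
  refine gramNorm_le (by positivity) fun u hu => ?_
  calc |gramForm E A u| = |gramForm E (offDiag A) u + RCLike.re A.trace| := by
        rw [gramForm_offDiag_add_trace A hu]
    _ ≤ 405 * (2 * c) + c := by
        refine (abs_add_le _ _).trans (add_le_add ?_ htrace)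
        calc |gramForm E (offDiag A) u| ≤ gramNorm (Set.Iic 1) E (offDiag A) :=
              abs_gramForm_le_gramNorm subset_rfl _ fun i => (hu i).le
          _ ≤ 405 * (2 * c) := (gramNorm_Iic_le_mul_scalar _).trans (by gcongr)
    _ = 811 * c := by ring

end Sphere

section Identification

lemma sSup_setOf_exists_eq {α : Type*} (p : α → Prop) (f : α → ℝ) :
    sSup {t : ℝ | ∃ x, p x ∧ t = f x} = ⨆ x : {x // p x}, f x := by
  congr 1
  ext t
  simp only [Set.mem_ofPred_eq, Set.mem_range, Subtype.exists, exists_prop, eq_comm]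

section

variable {𝕜 ι : Type*} [RCLike 𝕜] [Fintype ι] {s : Set ℝ} {E : Type*} [NormedAddCommGroup E]
  [InnerProductSpace 𝕜 E] [NormedSpace ℝ E] [IsScalarTower ℝ 𝕜 E]

lemma gramNorm_eq_sSup {A : Matrix ι ι 𝕜} (hA : A.IsHermitian) :
    gramNorm s E A = sSup {t : ℝ | ∃ u : ι → E, (∀ i, ‖u i‖ ∈ s) ∧
      t = ‖∑ i, ∑ j, A i j * inner 𝕜 (u i) (u j)‖} := by
  simp only [gramNorm, sSup_setOf_exists_eq, norm_sum_mul_inner_eq_abs_gramForm hA]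

lemma gramNorm_eq_max_sSup (hs : s ⊆ Set.Iic 1) {e : ι → E} (he : ∀ i, ‖e i‖ ∈ s)
    (A : Matrix ι ι 𝕜) :
    gramNorm s E A = max (sSup {t : ℝ | ∃ u : ι → E, (∀ i, ‖u i‖ ∈ s) ∧ t = gramForm E A u})
      (sSup {t : ℝ | ∃ u : ι → E, (∀ i, ‖u i‖ ∈ s) ∧ t = gramForm E (-A) u}) := by
  have : Nonempty {u : ι → E // ∀ i, ‖u i‖ ∈ s} := ⟨⟨e, he⟩⟩
  have hbdd (B : Matrix ι ι 𝕜) :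
      BddAbove (Set.range fun u : {u : ι → E // ∀ i, ‖u i‖ ∈ s} => gramForm E B u) := by
    refine ⟨gramNorm s E B, ?_⟩
    rintro _ ⟨u, rfl⟩
    exact (le_abs_self _).trans (abs_gramForm_le_gramNorm hs B u.2)
  simp only [sSup_setOf_exists_eq]
  rw [← ciSup_sup_eq (hbdd A) (hbdd (-A))]
  simp only [gramNorm, gramForm_neg, abs]

lemma exists_posSemidef_and_iff {P : Matrix ι ι 𝕜 → Prop} :
    (∃ X : Matrix ι ι 𝕜, X.PosSemidef ∧ P X) ↔ ∃ u : ι → EuclideanSpace 𝕜 ι, P (gram 𝕜 u)ᵀ := by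
  refine ⟨fun ⟨X, hX, hP⟩ => ?_, fun ⟨u, hP⟩ => ⟨_, (posSemidef_gram 𝕜 u).transpose, hP⟩⟩
  obtain ⟨u, hu⟩ := exists_gram_eq hX.transpose
  exact ⟨u, by rwa [hu, transpose_transpose]⟩

end

variable {𝕜 : Type*} [RCLike 𝕜] {n : ℕ}

lemma gammaNorm_eq_gramNorm (d : ℕ) {A : Matrix (Fin n) (Fin n) 𝕜} (hA : A.IsHermitian) :
    gammaNorm d A = gramNorm {1} (EuclideanSpace 𝕜 (Fin d)) A := by
  simp only [gramNorm_eq_sSup hA, gammaNorm, Set.mem_singleton_iff]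

lemma GammaNorm_eq_gramNorm (d : ℕ) {A : Matrix (Fin n) (Fin n) 𝕜} (hA : A.IsHermitian) :
    GammaNorm d A = gramNorm (Set.Iic 1) (EuclideanSpace 𝕜 (Fin d)) A := by
  simp only [gramNorm_eq_sSup hA, GammaNorm, Set.mem_Iic]

lemma thetaNorm_eq_gramNorm {A : Matrix (Fin n) (Fin n) 𝕜} (hA : A.IsHermitian) :
    thetaNorm A = gramNorm {1} 𝕜 A := by
  rw [gramNorm_eq_sSup hA]
  simp only [RCLike.inner_apply', thetaNorm, Set.mem_singleton_iff, RCLike.star_def]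

lemma ThetaNorm_eq_gramNorm {A : Matrix (Fin n) (Fin n) 𝕜} (hA : A.IsHermitian) :
    ThetaNorm A = gramNorm (Set.Iic 1) 𝕜 A := by
  rw [gramNorm_eq_sSup hA]
  simp only [RCLike.inner_apply', ThetaNorm, Set.mem_Iic, RCLike.star_def]

lemma re_star_dotProduct_mulVec (A : Matrix (Fin n) (Fin n) 𝕜) (x : Fin n → 𝕜) :
    RCLike.re (star x ⬝ᵥ A.mulVec x) = gramForm 𝕜 A x := by
  simp only [gramForm_apply, dotProduct, mulVec, Finset.mul_sum, RCLike.inner_apply',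
    Pi.star_apply, RCLike.star_def, mul_left_comm]

lemma max_qEq_eq_gramNorm (A : Matrix (Fin n) (Fin n) 𝕜) :
    max (qEq A) (qEq (-A)) = gramNorm {1} 𝕜 A := by
  rw [gramNorm_eq_max_sSup (by simp) (e := fun _ => 1) (by simp)]
  simp only [qEq, re_star_dotProduct_mulVec, Set.mem_singleton_iff]

lemma max_qLe_eq_gramNorm (A : Matrix (Fin n) (Fin n) 𝕜) :
    max (qLe A) (qLe (-A)) = gramNorm (Set.Iic 1) 𝕜 A := by
  rw [gramNorm_eq_max_sSup subset_rfl (e := fun _ => 1) (by simp)]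
  simp only [qLe, re_star_dotProduct_mulVec, Set.mem_Iic]

lemma rEq_eq_sSup (A : Matrix (Fin n) (Fin n) 𝕜) :
    rEq A = sSup {t : ℝ | ∃ u : Fin n → EuclideanSpace 𝕜 (Fin n), (∀ i, ‖u i‖ ∈ ({1} : Set ℝ)) ∧
      t = gramForm (EuclideanSpace 𝕜 (Fin n)) A u} := by
  have hdiag (u : Fin n → EuclideanSpace 𝕜 (Fin n)) (i : Fin n) :
      (gram 𝕜 u)ᵀ i i = 1 ↔ ‖u i‖ = 1 := by
    rw [transpose_apply, gram_apply, inner_self_eq_norm_sq_to_K]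
    norm_cast
    exact pow_eq_one_iff_of_nonneg (norm_nonneg _) two_ne_zero
  simp only [rEq, exists_posSemidef_and_iff, hdiag, gramForm_eq_re_trace, Set.mem_singleton_iff]

lemma rLe_eq_sSup (A : Matrix (Fin n) (Fin n) 𝕜) :
    rLe A = sSup {t : ℝ | ∃ u : Fin n → EuclideanSpace 𝕜 (Fin n), (∀ i, ‖u i‖ ∈ Set.Iic (1 : ℝ)) ∧
      t = gramForm (EuclideanSpace 𝕜 (Fin n)) A u} := by
  have hdiag (u : Fin n → EuclideanSpace 𝕜 (Fin n)) (i : Fin n) :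
      RCLike.re ((gram 𝕜 u)ᵀ i i) ≤ 1 ↔ ‖u i‖ ≤ 1 := by
    rw [transpose_apply, gram_apply, inner_self_eq_norm_sq]
    exact sq_le_one_iff₀ (norm_nonneg _)
  simp only [rLe, exists_posSemidef_and_iff, hdiag, gramForm_eq_re_trace, Set.mem_Iic]

lemma max_rEq_eq_gramNorm (A : Matrix (Fin n) (Fin n) 𝕜) :
    max (rEq A) (rEq (-A)) = gramNorm {1} (EuclideanSpace 𝕜 (Fin n)) A := by
  rw [gramNorm_eq_max_sSup (by simp) (e := fun i => EuclideanSpace.single i 1) (by simp),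
    rEq_eq_sSup, rEq_eq_sSup]

lemma max_rLe_eq_gramNorm (A : Matrix (Fin n) (Fin n) 𝕜) :
    max (rLe A) (rLe (-A)) = gramNorm (Set.Iic 1) (EuclideanSpace 𝕜 (Fin n)) A := by
  rw [gramNorm_eq_max_sSup subset_rfl (e := fun i => EuclideanSpace.single i 1) (by simp),
    rLe_eq_sSup, rLe_eq_sSup]

end Identification

section Constants

variable {𝕜 : Type*} [RCLike 𝕜] {s : Set ℝ} {K : ℝ}

variable (𝕜 s) in
/-- The constants `K` for which the Grothendieck inequality between vectors in `𝕜^n` and scalars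
of norm in `s` holds for all Hermitian matrices. -/
def admissibleConstants : Set ℝ :=
  {K | ∀ (n : ℕ) (A : Matrix (Fin n) (Fin n) 𝕜), A.IsHermitian →
    gramNorm s (EuclideanSpace 𝕜 (Fin n)) A ≤ K * gramNorm s 𝕜 A}

lemma isClosed_admissibleConstants : IsClosed (admissibleConstants 𝕜 s) := by
  simp only [admissibleConstants, Set.ofPred_forall]
  refine isClosed_iInter fun n => isClosed_iInter fun A => isClosed_iInter fun _ => ?_
  exact isClosed_le continuous_const (continuous_id.mul continuous_const)

lemma one_le_of_mem_admissibleConstants (h1 : 1 ∈ s) (hs : s ⊆ Set.Iic 1)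
    (hK : K ∈ admissibleConstants 𝕜 s) : 1 ≤ K := by
  have hone : 0 < gramNorm s 𝕜 (1 : Matrix (Fin 1) (Fin 1) 𝕜) := by
    refine lt_of_lt_of_le ?_ (abs_gramForm_le_gramNorm hs 1 (u := fun _ => 1) (by simpa))
    simp [gramForm_apply]
  refine le_of_mul_le_mul_right ?_ hone
  rw [one_mul]
  exact (gramNorm_le_gramNorm_euclideanSpace hs 1).trans (hK 1 1 isHermitian_one)

lemma isLeast_sInf_admissibleConstants (h1 : 1 ∈ s) (hs : s ⊆ Set.Iic 1)
    (hne : (admissibleConstants 𝕜 s).Nonempty) :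
    IsLeast (admissibleConstants 𝕜 s) (sInf (admissibleConstants 𝕜 s)) :=
  isClosed_admissibleConstants.isLeast_csInf hne
    ⟨1, fun _ hK => one_le_of_mem_admissibleConstants h1 hs hK⟩

lemma mem_admissibleConstants_iff (hs : s ⊆ Set.Iic 1) :
    K ∈ admissibleConstants 𝕜 s ↔ ∀ n d : ℕ, n ≤ d → ∀ A : Matrix (Fin n) (Fin n) 𝕜,
      A.IsHermitian → gramNorm s (EuclideanSpace 𝕜 (Fin d)) A ≤ K * gramNorm s 𝕜 A :=
  ⟨fun hK n _ _ A hA => (gramNorm_le_gramNorm_euclideanSpace hs A).trans (hK n A hA),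
    fun hK n A hA => hK n n le_rfl A hA⟩

lemma isLeast_Kgamma : IsLeast (admissibleConstants 𝕜 {1}) (Kgamma 𝕜) := by
  have hset : {K : ℝ | ∀ n d : ℕ, n ≤ d → ∀ A : Matrix (Fin n) (Fin n) 𝕜, A.IsHermitian →
      gammaNorm d A ≤ K * thetaNorm A} = admissibleConstants 𝕜 {1} := by
    ext K
    rw [mem_admissibleConstants_iff (by simp), Set.mem_ofPred_eq]
    refine forall₅_congr fun n d _ A hA => ?_
    rw [gammaNorm_eq_gramNorm d hA, thetaNorm_eq_gramNorm hA]
  rw [Kgamma, hset]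
  exact isLeast_sInf_admissibleConstants rfl (by simp)
    ⟨811, fun _ A _ => gramNorm_singleton_le_mul_scalar A⟩

lemma isLeast_KGamma : IsLeast (admissibleConstants 𝕜 (Set.Iic 1)) (KGamma 𝕜) := by
  have hset : {K : ℝ | ∀ n d : ℕ, n ≤ d → ∀ A : Matrix (Fin n) (Fin n) 𝕜, A.IsHermitian →
      GammaNorm d A ≤ K * ThetaNorm A} = admissibleConstants 𝕜 (Set.Iic 1) := by
    ext K
    rw [mem_admissibleConstants_iff subset_rfl, Set.mem_ofPred_eq]
    refine forall₅_congr fun n d _ A hA => ?_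
    rw [GammaNorm_eq_gramNorm d hA, ThetaNorm_eq_gramNorm hA]
  rw [KGamma, hset]
  exact isLeast_sInf_admissibleConstants (by simp) subset_rfl
    ⟨405, fun _ A _ => gramNorm_Iic_le_mul_scalar A⟩

end Constants

end SymGrothendieck

theorem theorem6p2 {𝕜 : Type*} [RCLike 𝕜] :
    (∀ (n : ℕ) (A : Matrix (Fin n) (Fin n) 𝕜), A.IsHermitian →
      (max (qEq A) (qEq (-A)) ≤ max (rEq A) (rEq (-A)) ∧
        max (rEq A) (rEq (-A)) ≤ Kgamma 𝕜 * max (qEq A) (qEq (-A))) ∧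
      (max (qLe A) (qLe (-A)) ≤ max (rLe A) (rLe (-A)) ∧
        max (rLe A) (rLe (-A)) ≤ KGamma 𝕜 * max (qLe A) (qLe (-A)))) ∧
    (∀ K : ℝ,
      (∀ (n : ℕ) (A : Matrix (Fin n) (Fin n) 𝕜), A.IsHermitian →
        max (rEq A) (rEq (-A)) ≤ K * max (qEq A) (qEq (-A))) → Kgamma 𝕜 ≤ K) ∧
    (∀ K : ℝ,
      (∀ (n : ℕ) (A : Matrix (Fin n) (Fin n) 𝕜), A.IsHermitian →
        max (rLe A) (rLe (-A)) ≤ K * max (qLe A) (qLe (-A))) → KGamma 𝕜 ≤ K) := by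
  simp only [max_qEq_eq_gramNorm, max_qLe_eq_gramNorm, max_rEq_eq_gramNorm, max_rLe_eq_gramNorm]
  refine ⟨fun n A hA => ⟨⟨?_, ?_⟩, ?_, ?_⟩, ?_, ?_⟩
  · exact gramNorm_le_gramNorm_euclideanSpace (by simp) A
  · exact isLeast_Kgamma.1 n A hA
  · exact gramNorm_le_gramNorm_euclideanSpace subset_rfl A
  · exact isLeast_KGamma.1 n A hA
  · exact fun K hK => isLeast_Kgamma.2 hK
  · exact fun K hK => isLeast_KGamma.2 hK
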